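/- **Conventions.** A rooted graph $(X,E)$ is a connected, locally finite (undirected, loopless) graph with a root $\vartheta$; $d$ is its graph distance, $|x|=d(\vartheta,x)$, $X_n=\{x:|x|=n\}$, and $\mathcal J_m(x)$ is the set of $y\in X$ with $|y|=|x|+m$ such that $x$ lies on a geodesic from $\vartheta$ to $y$. An edge is vertical if its endpoints have levels $|\cdot|$ differing by $1$, and horizontal if its endpoints have the same level; this gives $E=E_v\cup E_h$, and $(X,E)$ is vertical if $E=E_v$. Let $d_h\in\{0,1,\dots,\infty\}$ be the graph distance of $(X,E_h)$. For positive integers $m,k$, $(X,E)$ is $(m,k)$-departing if $d_h(x,y)>k$ implies $d_h(u,v)>2k$ for all $u\in\mathcal J_m(x)$, $v\in\mathcal J_m(y)$; it is expansive if $d_h(x,y)>1$ implies $d_h(u,v)>1$ for all $u\in\mathcal J_1(x)$, $v\in\mathcal J_1(y)$. With $(x|y)=\frac12(|x|+|y|-d(x,y))$, $(X,E)$ is hyperbolic if for some $\delta\ge 0$ one has $(x|y)\ge\min\{(x|z),(z|y)\}-\delta$ for all $x,y,z\in X$. For such a $\delta$ and any $a>0$ with $e^{\delta a}<\sqrt2$,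 the Gromov metric on $X$ is $\theta_a(x,x)=0$ and $\theta_a(x,y)=\inf\sum_{i=1}^n e^{-a(x_{i-1}|x_i)}$ for $x\ne y$, the infimum being over all $n\ge 1$ and all $x=x_0,x_1,\dots,x_n=y$ in $X$; the hyperbolic boundary $\partial X$ is the $\theta_a$-completion of $X$ minus $X$, with the extended metric $\theta_a$. A ray is a sequence ${\bf x}=[x_i]_{i\ge0}$ with $x_0=\vartheta$ and $x_{i+1}\in\mathcal J_1(x_i)$ for all $i$. **Setting.** Let $(M,\rho)$ be a complete metric space and $(X,E_v)$ a vertical rooted graph with $\mathcal J_1(x)\neq\emptyset$ for all $x\in X$. Let $\Phi$ be an index map on $(X,E_v)$ over $(M,\rho)$, i.e. a map from $X$ to the nonempty compact subsets of $M$ such that $\Phi(y)\subset\Phi(x)$ whenever $y\in\mathcal J_1(x)$, and $\bigcap_i\Phi(x_i)$ is a singleton, whose element is denoted $\kappa_0({\bf x})$, for every ray ${\bf x}$. Let $K=\bigcap_{n\ge0}\bigcup_{x\in X_n}\Phi(x)$ be its attractor. Let $b>0$ and assume that $\Phi$ is of exponential type-$(b)$: $\operatorname{diam}_\rho\Phi(x)=O(e^{-b|x|})$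 as $|x|\to\infty$. Fix $\gamma>0$ and let $(X,E^{(b)})$ be the $AI_b$-graph: $E^{(b)}=E_v\cup E_h^{(b)}$, where $(x,y)\in E_h^{(b)}$ if and only if $x\ne y$, $|x|=|y|$ and $\operatorname{dist}_\rho(\Phi(x),\Phi(y))\le\gamma e^{-b|x|}$. **Theorem.** There is an integer $m\ge1$ such that $(X,E^{(b)})$ is $(m,1)$-departing. Moreover $(X,E^{(b)})$ is admissible (associated to $\Phi$): it is an expansive (in particular rooted) hyperbolic graph, $\Phi$ is an index map on its vertical part over $(M,\rho)$, and $\kappa_0$ induces a well-defined bijection $\kappa:\partial X\to K$; that is, every ray converges to a point of $\partial X$, every $\xi\in\partial X$ is the limit of some ray, and $\kappa(\xi)=\kappa_0({\bf x})$ for every ray ${\bf x}$ converging to $\xi$. Finally, $\kappa:(\partial X,\theta_a)\to(K,\rho)$ is a Hölder equivalence with exponent $b/a$: for every $a>0$ with $e^{\delta a}<\sqrt2$ for some hyperbolicity constant $\delta\ge 0$ of $(X,E^{(b)})$ there is $C\ge1$ with $$C^{-1}\rho(\kappa(\xi),\kappa(\eta))^{a/b}\le\theta_a(\xi,\eta)\le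 C\,\rho(\kappa(\xi),\kappa(\eta))^{a/b}\qquad\text{for all }\xi,\eta\in\partial X.$$ -/

import Mathlib

open Filter Topology TopologicalSpace Asymptotics

noncomputable section

namespace IndexGraph

variable {X : Type*}

/-! ### Rooted graphs -/

/-- A rooted graph: a connected, locally finite graph, in which a vertex has been chosen as root
(the root is passed separately to all later definitions). -/
structure IsRootedGraph (G : SimpleGraph X) : Prop where
  connected : G.Connected
  locallyFinite : ∀ x, (G.neighborSet x).Finite

/-- `|x|`, the graph distance from the root `o` to `x`. -/
def level (G : SimpleGraph X) (o x : X) : ℕ := G.dist o x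

/-- `y ≺ x`: the vertex `x` lies on some geodesic from the root `o` to `y`. -/
def Prec (G : SimpleGraph X) (o y x : X) : Prop :=
  G.dist o x + G.dist x y = G.dist o y

/-- `𝒥_m(x)`, the set of descendants of `x` in the `m`-th generation. -/
def descendants (G : SimpleGraph X) (o : X) (m : ℕ) (x : X) : Set X :=
  {y | Prec G o y x ∧ level G o y = level G o x + m}

/-- The graph `(X, E_v)` formed by the vertical edges. -/
def verticalPart (G : SimpleGraph X) (o : X) : SimpleGraph X where
  Adj x y := G.Adj x y ∧ (level G o x = level G o y + 1 ∨ level G o y = level G o x + 1)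
  symm := ⟨fun _ _ h => ⟨h.1.symm, h.2.symm⟩⟩
  loopless := ⟨fun _ h => G.irrefl h.1⟩

/-- The graph `(X, E_h)` formed by the horizontal edges. -/
def horizontalPart (G : SimpleGraph X) (o : X) : SimpleGraph X where
  Adj x y := G.Adj x y ∧ level G o x = level G o y
  symm := ⟨fun _ _ h => ⟨h.1.symm, h.2.symm⟩⟩
  loopless := ⟨fun _ h => G.irrefl h.1⟩

/-- The horizontal distance `d_h`: the (extended) graph distance of `(X, E_h)`. -/
def horizDist (G : SimpleGraph X) (o x y : X) : ℕ∞ := (horizontalPart G o).edist x y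

/-- A rooted graph is vertical if all its edges are vertical. -/
def IsVertical (G : SimpleGraph X) (o : X) : Prop := G = verticalPart G o

/-- Expansive graphs. -/
structure IsExpansive (G : SimpleGraph X) (o : X) : Prop where
  rooted : IsRootedGraph G
  expansive : ∀ x y, 1 < horizDist G o x y →
    ∀ u ∈ descendants G o 1 x, ∀ v ∈ descendants G o 1 y, 1 < horizDist G o u v

/-- The `(m, k)`-departing property. -/
def IsDeparting (G : SimpleGraph X) (o : X) (m k : ℕ) : Prop :=
  ∀ x y, (k : ℕ∞) < horizDist G o x y →
    ∀ u ∈ descendants G o m x, ∀ v ∈ descendants G o m y, (2 * k : ℕ∞) < horizDist G o u v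

/-- The rays `[x_i]` starting from the root and descending one generation at each step. -/
def IsRay (G : SimpleGraph X) (o : X) (x : ℕ → X) : Prop :=
  x 0 = o ∧ ∀ i, x (i + 1) ∈ descendants G o 1 (x i)

/-! ### Hyperbolicity, Gromov metric and hyperbolic boundary -/

/-- The Gromov product `(x|y)` with respect to the root. -/
def gromovProduct (G : SimpleGraph X) (o x y : X) : ℝ :=
  ((level G o x : ℝ) + level G o y - G.dist x y) / 2

/-- Gromov's hyperbolicity inequality with constant `δ`. -/
def IsHyperbolicWith (G : SimpleGraph X) (o : X) (δ : ℝ) : Prop :=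
  ∀ x y z, min (gromovProduct G o x z) (gromovProduct G o z y) - δ ≤ gromovProduct G o x y

/-- Gromov hyperbolic rooted graphs. -/
def IsHyperbolic (G : SimpleGraph X) (o : X) : Prop :=
  ∃ δ : ℝ, 0 ≤ δ ∧ IsHyperbolicWith G o δ

/-- The parameters `a > 0` for which the Gromov metric `θ_a` is considered:
`e^{δ a} < √2` for some hyperbolicity constant `δ ≥ 0` of the graph. -/
def IsGromovParameter (G : SimpleGraph X) (o : X) (a : ℝ) : Prop :=
  0 < a ∧ ∃ δ : ℝ, 0 ≤ δ ∧ IsHyperbolicWith G o δ ∧ Real.exp (δ * a) < √2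

/-- The values `∑ e^{-a (z_{i} | z_{i+1})}` over all finite chains from `x` to `y` with at least
one step. -/
def chainSums (G : SimpleGraph X) (o : X) (a : ℝ) (x y : X) : Set ℝ :=
  {s | ∃ n : ℕ, 1 ≤ n ∧ ∃ z : ℕ → X, z 0 = x ∧ z n = y ∧
    s = ∑ i ∈ Finset.range n, Real.exp (-a * gromovProduct G o (z i) (z (i + 1)))}

open Classical in
/-- The Gromov metric `θ_a` on the set of vertices. -/
def theta (G : SimpleGraph X) (o : X) (a : ℝ) (x y : X) : ℝ :=
  if x = y then 0 else sInf (chainSums G o a x y)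

theorem gromovProduct_comm (G : SimpleGraph X) (o x y : X) :
    gromovProduct G o x y = gromovProduct G o y x := by
  unfold gromovProduct
  rw [G.dist_comm (u := x)]
  ring

theorem chainSums_nonempty (G : SimpleGraph X) (o : X) (a : ℝ) (x y : X) :
    (chainSums G o a x y).Nonempty :=
  ⟨_, 1, le_rfl, fun i => if i = 0 then x else y, by simp, by simp, rfl⟩

theorem chainSums_nonneg {G : SimpleGraph X} {o : X} {a : ℝ} {x y : X} {s : ℝ}
    (h : s ∈ chainSums G o a x y) : 0 ≤ s := by
  obtain ⟨n, -, z, -, -, rfl⟩ := h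
  exact Finset.sum_nonneg fun i _ => (Real.exp_pos _).le

theorem chainSums_bddBelow (G : SimpleGraph X) (o : X) (a : ℝ) (x y : X) :
    BddBelow (chainSums G o a x y) := ⟨0, fun _ h => chainSums_nonneg h⟩

theorem chainSums_symm {G : SimpleGraph X} {o : X} {a : ℝ} {x y : X} {s : ℝ}
    (h : s ∈ chainSums G o a x y) : s ∈ chainSums G o a y x := by
  obtain ⟨n, hn, z, h0, h1, rfl⟩ := h
  refine ⟨n, hn, fun i => z (n - i), by simpa using h1, by simpa using h0, ?_⟩
  rw [← Finset.sum_range_reflect]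
  refine Finset.sum_congr rfl fun i hi => ?_
  have hi' := Finset.mem_range.1 hi
  have e1 : n - 1 - i = n - (i + 1) := by omega
  have e2 : n - 1 - i + 1 = n - i := by omega
  rw [gromovProduct_comm, e2, e1]

theorem chainSums_add {G : SimpleGraph X} {o : X} {a : ℝ} {x y w : X} {s t : ℝ}
    (hs : s ∈ chainSums G o a x y) (ht : t ∈ chainSums G o a y w) :
    s + t ∈ chainSums G o a x w := by
  obtain ⟨n, hn, z, h0, h1, rfl⟩ := hs
  obtain ⟨m, hm, z', h0', h1', rfl⟩ := ht
  refine ⟨n + m, by omega, fun i => if i ≤ n then z i else z' (i - n), by simpa using h0, ?_, ?_⟩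
  · have : ¬ (n + m ≤ n) := by omega
    simpa [this] using h1'
  · rw [Finset.sum_range_add]
    congr 1
    · refine Finset.sum_congr rfl fun i hi => ?_
      have hi' := Finset.mem_range.1 hi
      simp [hi'.le, Nat.succ_le_of_lt hi']
    · refine Finset.sum_congr rfl fun i _ => ?_
      have e1 : ¬ (n + i + 1 ≤ n) := by omega
      have e2 : n + i + 1 - n = i + 1 := by omega
      rcases Nat.eq_zero_or_pos i with rfl | hi
      · simp [h1, h0']
      · have e3 : ¬ (n + i ≤ n) := by omega
        simp only [e1, e2, e3, if_false, Nat.add_sub_cancel_left]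

theorem theta_nonneg (G : SimpleGraph X) (o : X) (a : ℝ) (x y : X) : 0 ≤ theta G o a x y := by
  unfold theta
  split_ifs
  · exact le_rfl
  · exact Real.sInf_nonneg fun _ h => chainSums_nonneg h

theorem theta_le {G : SimpleGraph X} {o : X} {a : ℝ} {x y : X} {s : ℝ}
    (h : s ∈ chainSums G o a x y) : theta G o a x y ≤ s := by
  unfold theta
  split_ifs
  · exact chainSums_nonneg h
  · exact csInf_le (chainSums_bddBelow G o a x y) h

theorem theta_comm (G : SimpleGraph X) (o : X) (a : ℝ) (x y : X) :
    theta G o a x y = theta G o a y x := by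
  have e : chainSums G o a x y = chainSums G o a y x :=
    Set.ext fun _ => ⟨chainSums_symm, chainSums_symm⟩
  unfold theta
  by_cases h : x = y
  · simp [h]
  · simp [h, Ne.symm h, e]

theorem theta_triangle (G : SimpleGraph X) (o : X) (a : ℝ) (x y w : X) :
    theta G o a x w ≤ theta G o a x y + theta G o a y w := by
  by_cases hxy : x = y
  · subst hxy
    simp [theta]
  by_cases hyw : y = w
  · subst hyw
    simp [theta]
  refine le_of_forall_pos_le_add fun ε hε => ?_
  have e1 : theta G o a x y = sInf (chainSums G o a x y) := by simp [theta, hxy]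
  have e2 : theta G o a y w = sInf (chainSums G o a y w) := by simp [theta, hyw]
  obtain ⟨s, hs, hs'⟩ := Real.lt_sInf_add_pos (chainSums_nonempty G o a x y) (half_pos hε)
  obtain ⟨t, ht, ht'⟩ := Real.lt_sInf_add_pos (chainSums_nonempty G o a y w) (half_pos hε)
  have := theta_le (chainSums_add hs ht)
  linarith

/-- The set of vertices, regarded as a space with the distance `θ_a`. -/
def GromovSpace (_G : SimpleGraph X) (_o : X) (_a : ℝ) : Type _ := X

instance (G : SimpleGraph X) (o : X) (a : ℝ) : PseudoMetricSpace (GromovSpace G o a) where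
  dist := theta G o a
  dist_self x := by simp [theta]
  dist_comm := theta_comm G o a
  dist_triangle := theta_triangle G o a

/-- The `θ_a`-completion of the set of vertices, a metric space whose distance extends `θ_a`. -/
abbrev GromovCompletion (G : SimpleGraph X) (o : X) (a : ℝ) : Type _ :=
  UniformSpace.Completion (GromovSpace G o a)

/-- The canonical map from the vertices to the `θ_a`-completion. -/
def toCompletion (G : SimpleGraph X) (o : X) (a : ℝ) (x : X) : GromovCompletion G o a :=
  ((show GromovSpace G o a from x : GromovSpace G o a) : GromovCompletion G o a)

/-- The hyperbolic boundary `∂X`: the points of the `θ_a`-completion which are not vertices. -/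
def boundary (G : SimpleGraph X) (o : X) (a : ℝ) : Set (GromovCompletion G o a) :=
  (Set.range (toCompletion G o a))ᶜ

/-- The sequence of vertices `x` converges to `ξ` in the `θ_a`-completion. -/
def ConvergesTo (G : SimpleGraph X) (o : X) (a : ℝ) (x : ℕ → X) (ξ : GromovCompletion G o a) :
    Prop :=
  Tendsto (fun i => toCompletion G o a (x i)) atTop (𝓝 ξ)

/-! ### Index maps, attractors and admissible graphs -/

variable {M : Type*} [MetricSpace M]

/-- Index maps on a vertical graph, with values in the nonempty compact subsets of `M`. -/
structure IsIndexMap (G : SimpleGraph X) (o : X) (Φ : X → NonemptyCompacts M) : Prop where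
  subset : ∀ x, ∀ y ∈ descendants G o 1 x, (Φ y : Set M) ⊆ Φ x
  singleton : ∀ x : ℕ → X, IsRay G o x → ∃ p : M, ⋂ i, (Φ (x i) : Set M) = {p}

/-- The attractor `K` of an index map. -/
def attractor (G : SimpleGraph X) (o : X) (Φ : X → NonemptyCompacts M) : Set M :=
  ⋂ n : ℕ, ⋃ x ∈ {x | level G o x = n}, (Φ x : Set M)

/-- `κ : ∂X → K` (where `K` is the attractor of `Φ`) is the map induced by `Φ`: every ray converges to a point of `∂X`, every point of
`∂X` is the limit of a ray, and whenever a ray `[x_i]` converges to `ξ`, the point `κ(ξ)` is the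
unique element of `⋂ Φ(x_i)`. There is at most one such `κ`. -/
structure IsInducedMap (G : SimpleGraph X) (o : X) (Φ : X → NonemptyCompacts M) (a : ℝ)
    {K : Set M} (κ : boundary G o a → K) : Prop where
  ray_converges : ∀ x : ℕ → X, IsRay G o x → ∃ ξ : boundary G o a, ConvergesTo G o a x ξ
  exists_ray : ∀ ξ : boundary G o a, ∃ x : ℕ → X, IsRay G o x ∧ ConvergesTo G o a x ξ
  eq : ∀ (x : ℕ → X) (ξ : boundary G o a), IsRay G o x → ConvergesTo G o a x ξ →
    ⋂ i, (Φ (x i) : Set M) = {(κ ξ : M)}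

/-- Admissible graphs associated to `Φ`: expansive hyperbolic graphs such that `Φ` is an index map
on the vertical part and induces a well-defined bijection from the hyperbolic boundary (formed with
any admitted parameter `a`) onto the attractor. -/
structure IsAdmissible (G : SimpleGraph X) (o : X) (Φ : X → NonemptyCompacts M) : Prop where
  expansive : IsExpansive G o
  hyperbolic : IsHyperbolic G o
  indexMap : IsIndexMap (verticalPart G o) o Φ
  bijection : ∀ a : ℝ, IsGromovParameter G o a →
    ∃ κ : boundary G o a → attractor (verticalPart G o) o Φ,
      IsInducedMap G o Φ a κ ∧ Function.Bijective κ

/-- `Φ` is of exponential type-`(b)`: the diameter of `Φ(x)` is `O(e^{-b|x|})` as `|x| → ∞`. -/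
def IsExponentialType (G : SimpleGraph X) (o : X) (Φ : X → NonemptyCompacts M) (b : ℝ) : Prop :=
  (fun x => Metric.diam (Φ x : Set M)) =O[comap (level G o) atTop]
    fun x => Real.exp (-b * level G o x)

/-- The distance `inf {ρ(p, q) : p ∈ A, q ∈ B}` of two nonempty sets. -/
def setDist (A B : Set M) : ℝ := sInf (Set.image2 dist A B)

theorem setDist_comm (A B : Set M) : setDist A B = setDist B A := by
  unfold setDist
  rw [Set.image2_swap]
  simp only [dist_comm]

/-- The `AI_b`-graph (with constant `γ`) over the vertical graph `G`: two distinct vertices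
`x`, `y` of the same level `n` are joined by a horizontal edge if and only if
`dist(Φ(x), Φ(y)) ≤ γ e^{-bn}`. -/
def aiGraph (G : SimpleGraph X) (o : X) (Φ : X → NonemptyCompacts M) (b γ : ℝ) :
    SimpleGraph X where
  Adj x y := G.Adj x y ∨ (level G o x = level G o y ∧ x ≠ y ∧
    setDist (Φ x : Set M) (Φ y) ≤ γ * Real.exp (-b * level G o x))
  symm := ⟨fun x y h => by
    rcases h with h | ⟨h1, h2, h3⟩
    · exact Or.inl h.symm
    · refine Or.inr ⟨h1.symm, h2.symm, ?_⟩
      rw [setDist_comm, ← h1]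
      exact h3⟩
  loopless := ⟨fun x h => by
    rcases h with h | h
    · exact G.irrefl h
    · exact h.2.1 rfl⟩

end IndexGraph

end

open IndexGraph

/-!
The key is to compare the Gromov product of the `AI_b`-graph with a quantity that does not refer to
its edges. Choose a point `f x ∈ Φ x` for each vertex `x`, and let
`D(x, y) = e^{-b|x|} + e^{-b|y|} + ρ(f x, f y)` (`levelDist`). Then `D` and `e^{-b(x|y)}` are
comparable.

* `D ≤ c e^{-b(x|y)}` (`exists_levelDist_le`): the points `f z`, `f z'` of neighbours are at distance
  `O(e^{-b|z|})`. The level changes by at most one at each step, so along the two halves of a geodesic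
  from `x` to `y`, cut at a distance of about `|x| - (x|y)` from `x`, these contributions are
  dominated by geometric series whose largest terms are about `e^{-b(x|y)}`.
* `e^{-b(x|y)} ≤ c D` (`exists_exp_gromovProduct_le`): if `ρ(f x, f y) ≤ γ e^{-bn}`, the ancestors of
  `x` and `y` on level `n` are equal or horizontal neighbours, hence `(x|y) ≥ n - 1/2`.

Since `D` satisfies the triangle inequality, the graph is hyperbolic. Frink's metrization lemma shows
that `θ_a(x, y)` is comparable with `e^{-a(x|y)}` for `x ≠ y` (`exp_le_two_mul_theta`; this is where
`e^{δa} < √2` enters), hence with `D(x, y)^{a/b}`. Along two rays, `θ_a` tends to the distance of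
their limits in the boundary, and `D` to the distance of the points of the attractor which they
determine. The Hölder estimate follows (`exists_ray_estimate`), and it implies that `κ` is well
defined and injective. König's lemma (`exists_ray_frequently_prec`) shows that every boundary point is
the limit of a ray, and that every point of the attractor comes from a ray. Expansiveness and the
departing property are direct consequences of the definition of the horizontal edges.
-/

namespace IndexGraph

/-! ### Vertical rooted graphs -/

section Vertical

variable {X : Type*} {G : SimpleGraph X} {o : X}

theorem level_self (G : SimpleGraph X) (o : X) : level G o o = 0 := by simp [level]

theorem IsVertical.level_eq_or (hv : IsVertical G o) {x y : X} (h : G.Adj x y) :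
    level G o x = level G o y + 1 ∨ level G o y = level G o x + 1 := by
  rw [hv] at h
  exact h.2

theorem level_le_add_dist (hG : IsRootedGraph G) (x y : X) :
    level G o y ≤ level G o x + G.dist x y :=
  hG.connected.dist_triangle

theorem mem_descendants_one_iff {x y : X} :
    y ∈ descendants G o 1 x ↔ G.Adj x y ∧ level G o y = level G o x + 1 := by
  simp only [descendants, Set.mem_ofPred_eq, Prec, ← SimpleGraph.dist_eq_one_iff_adj, level]
  omega

theorem finite_descendants_one (hG : IsRootedGraph G) (x : X) :
    (descendants G o 1 x).Finite :=
  (hG.locallyFinite x).subset fun _ h => (mem_descendants_one_iff.1 h).1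

theorem prec_root (G : SimpleGraph X) (o x : X) : Prec G o x o := by simp [Prec]

/-- A geodesic from `x` to a proper descendant `y` passes through a child of `x`. -/
theorem Prec.exists_child (hG : IsRootedGraph G) (hv : IsVertical G o) {x y : X}
    (h : Prec G o y x) (hxy : x ≠ y) :
    ∃ z ∈ descendants G o 1 x, Prec G o y z := by
  obtain ⟨w, hw⟩ := hG.connected.exists_walk_length_eq_dist x y
  cases w with
  | nil => exact absurd rfl hxy
  | @cons _ z _ hz w =>
    have h1 := SimpleGraph.dist_le w
    have h2 := hv.level_eq_or hz
    have h3 := level_le_add_dist (o := o) hG z y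
    rw [SimpleGraph.Walk.length_cons] at hw
    unfold Prec at h
    unfold level at h2 h3
    refine ⟨z, mem_descendants_one_iff.2 ⟨hz, ?_⟩, ?_⟩
    · unfold level
      omega
    · unfold Prec
      omega

/-- Induction from a vertex `y` upwards: a property that holds for `y`, and passes from each vertex to
its parents, holds for all ancestors of `y`. -/
theorem Prec.induction (hG : IsRootedGraph G) (hv : IsVertical G o) {y : X} {P : X → Prop}
    (base : P y) (step : ∀ x, ∀ z ∈ descendants G o 1 x, P z → P x) {x : X}
    (h : Prec G o y x) : P x := by
  obtain ⟨n, hn⟩ : ∃ n, G.dist x y = n := ⟨_, rfl⟩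
  induction n using Nat.strong_induction_on generalizing x with
  | _ n ih =>
    by_cases hxy : x = y
    · exact hxy ▸ base
    · obtain ⟨z, hz, hz'⟩ := h.exists_child hG hv hxy
      refine step x z hz (ih _ ?_ hz' rfl)
      have := hz.2
      unfold level at this
      unfold Prec at h hz'
      omega

theorem exists_prec_level_eq (hG : IsRootedGraph G) (hv : IsVertical G o) (x : X) {n : ℕ}
    (hn : n ≤ level G o x) : ∃ z, Prec G o x z ∧ level G o z = n := by
  induction n with
  | zero => exact ⟨o, prec_root G o x, level_self G o⟩
  | succ n ih =>
    obtain ⟨z, hz, hzn⟩ := ih (by omega)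
    obtain ⟨z', hz', h⟩ := hz.exists_child hG hv (by rintro rfl; omega)
    exact ⟨z', h, by rw [hz'.2, hzn]⟩

theorem finite_level_eq (hG : IsRootedGraph G) (hv : IsVertical G o) (n : ℕ) :
    {x | level G o x = n}.Finite := by
  induction n with
  | zero =>
    refine (Set.finite_singleton o).subset fun x hx => ?_
    exact ((hG.connected.dist_eq_zero_iff).1 hx).symm
  | succ n ih =>
    refine (ih.biUnion fun x _ => finite_descendants_one (o := o) hG x).subset fun x hx => ?_
    obtain ⟨z, hz, hzn⟩ := exists_prec_level_eq hG hv x (n := n) (by rw [hx]; omega)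
    obtain ⟨z', hz', h⟩ := hz.exists_child hG hv (by rintro rfl; rw [hx] at hzn; omega)
    refine Set.mem_biUnion (x := z) hzn ?_
    have : G.dist o z' + G.dist z' x = G.dist o x := h
    have h2 := hz'.2
    have h3 : level G o x = n + 1 := hx
    unfold level at h2 h3 hzn
    rwa [← (hG.connected.dist_eq_zero_iff (u := z') (v := x)).1 (by omega)]

theorem finite_level_lt (hG : IsRootedGraph G) (hv : IsVertical G o) (n : ℕ) :
    {x | level G o x < n}.Finite :=
  ((Set.finite_Iio n).biUnion fun k _ => finite_level_eq (o := o) hG hv k).subset fun x hx =>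
    Set.mem_biUnion (x := level G o x) hx rfl

theorem IsRay.level_eq {x : ℕ → X} (hx : IsRay G o x) (i : ℕ) : level G o (x i) = i := by
  induction i with
  | zero => rw [hx.1, level_self]
  | succ i ih => rw [(hx.2 i).2, ih]

theorem IsRay.dist_le (hG : IsRootedGraph G) {x : ℕ → X} (hx : IsRay G o x) (i k : ℕ) :
    G.dist (x i) (x (i + k)) ≤ k := by
  induction k with
  | zero => simp
  | succ k ih =>
    have h1 := hG.connected.dist_triangle (u := x i) (v := x (i + k)) (w := x (i + (k + 1)))
    have h2 := SimpleGraph.dist_eq_one_iff_adj.2 (mem_descendants_one_iff.1 (hx.2 (i + k))).1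
    rw [add_assoc] at h2
    omega

/-- A form of König's lemma: if the levels of the vertices `v j` tend to infinity, some ray consists
of vertices which are ancestors of infinitely many `v j`. -/
theorem exists_ray_frequently_prec (hG : IsRootedGraph G) (hv : IsVertical G o) {v : ℕ → X}
    (h : Tendsto (fun j => level G o (v j)) atTop atTop) :
    ∃ u, IsRay G o u ∧ ∀ i, ∃ᶠ j in atTop, Prec G o (v j) (u i) := by
  have step : ∀ x : {x // ∃ᶠ j in atTop, Prec G o (v j) x},
      ∃ y : {x // ∃ᶠ j in atTop, Prec G o (v j) x}, (y : X) ∈ descendants G o 1 (x : X) := by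
    rintro ⟨x, hx⟩
    by_contra hcon
    have h1 : ∀ y ∈ descendants G o 1 x, ∀ᶠ j in atTop, ¬ Prec G o (v j) y := by
      intro y hy
      rw [← not_frequently]
      exact fun hf => hcon ⟨⟨y, hf⟩, hy⟩
    have h2 := ((finite_descendants_one hG x).eventually_all).2 h1
    have h3 := h.eventually_gt_atTop (level G o x)
    obtain ⟨j, hj, hj2, hj3⟩ := (hx.and_eventually (h2.and h3)).exists
    obtain ⟨y, hy, hy'⟩ := hj.exists_child hG hv (by rintro rfl; omega)
    exact hj2 y hy hy'
  choose f hf using step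
  obtain ⟨u, h0, hu⟩ : ∃ u : ℕ → {x // ∃ᶠ j in atTop, Prec G o (v j) x},
      (u 0 : X) = o ∧ ∀ n, u (n + 1) = f (u n) :=
    ⟨fun n => Nat.rec ⟨o, (Eventually.of_forall fun j => prec_root G o (v j)).frequently⟩
      (fun _ x => f x) n, rfl, fun _ => rfl⟩
  refine ⟨fun n => (u n).1, ⟨h0, fun i => ?_⟩, fun i => (u i).2⟩
  simp only [hu]
  exact hf (u i)

end Vertical

/-! ### The levels and the horizontal edges of the `AI_b`-graph -/

section AIGraph

variable {X M : Type*} [MetricSpace M] {G : SimpleGraph X} {o : X} {Φ : X → NonemptyCompacts M}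
  {b γ : ℝ}

theorem le_aiGraph (G : SimpleGraph X) (o : X) (Φ : X → NonemptyCompacts M) (b γ : ℝ) :
    G ≤ aiGraph G o Φ b γ := fun _ _ h => Or.inl h

theorem aiGraph_connected (hG : IsRootedGraph G) : (aiGraph G o Φ b γ).Connected :=
  hG.connected.mono (le_aiGraph G o Φ b γ)

theorem aiGraph_dist_le (hG : IsRootedGraph G) (x y : X) :
    (aiGraph G o Φ b γ).dist x y ≤ G.dist x y :=
  SimpleGraph.Reachable.dist_anti (le_aiGraph G o Φ b γ) (hG.connected x y)

theorem level_le_of_aiGraph_adj (hv : IsVertical G o) {x y : X}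
    (h : (aiGraph G o Φ b γ).Adj x y) : level G o y ≤ level G o x + 1 := by
  rcases h with h | h
  · have := hv.level_eq_or h
    omega
  · omega

theorem level_le_of_aiGraph_walk (hv : IsVertical G o) {x y : X}
    (w : (aiGraph G o Φ b γ).Walk x y) : level G o y ≤ level G o x + w.length := by
  induction w with
  | nil => simp
  | cons h w ih =>
    have := level_le_of_aiGraph_adj hv h
    rw [SimpleGraph.Walk.length_cons]
    omega

/-- A walk of the `AI_b`-graph which goes down one level at each step uses vertical edges only. -/
theorem dist_le_of_aiGraph_walk (hG : IsRootedGraph G) (hv : IsVertical G o) {x y : X}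
    (w : (aiGraph G o Φ b γ).Walk x y) (h : level G o y = level G o x + w.length) :
    G.dist x y ≤ w.length := by
  induction w with
  | nil => simp
  | @cons x z y hz w ih =>
    have h1 := level_le_of_aiGraph_adj hv hz
    have h2 := level_le_of_aiGraph_walk hv w
    rw [SimpleGraph.Walk.length_cons] at h ⊢
    have h3 := ih (by omega)
    rcases hz with hz | hz
    · have h4 := SimpleGraph.dist_eq_one_iff_adj.2 hz
      have h5 := hG.connected.dist_triangle (u := x) (v := z) (w := y)
      omega
    · omega

theorem level_aiGraph (hG : IsRootedGraph G) (hv : IsVertical G o) (x : X) :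
    level (aiGraph G o Φ b γ) o x = level G o x := by
  refine le_antisymm (aiGraph_dist_le hG o x) ?_
  obtain ⟨w, hw⟩ := (aiGraph_connected (o := o) (Φ := Φ) (b := b) (γ := γ)
    hG).exists_walk_length_eq_dist o x
  have := level_le_of_aiGraph_walk hv w
  rw [level_self, zero_add, hw] at this
  exact this

theorem verticalPart_aiGraph (hG : IsRootedGraph G) (hv : IsVertical G o) :
    verticalPart (aiGraph G o Φ b γ) o = G := by
  ext x y
  simp only [verticalPart, level_aiGraph hG hv]
  refine ⟨fun ⟨h, h'⟩ => h.resolve_right fun h2 => by omega, fun h => ⟨Or.inl h, hv.level_eq_or h⟩⟩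

theorem horizontalPart_aiGraph_adj (hG : IsRootedGraph G) (hv : IsVertical G o) {x y : X} :
    (horizontalPart (aiGraph G o Φ b γ) o).Adj x y ↔ level G o x = level G o y ∧ x ≠ y ∧
      setDist (Φ x : Set M) (Φ y) ≤ γ * Real.exp (-b * level G o x) := by
  simp only [horizontalPart, level_aiGraph hG hv]
  refine ⟨fun ⟨h, h'⟩ => h.resolve_left fun h2 => ?_, fun h => ⟨Or.inr h, h.1⟩⟩
  have := hv.level_eq_or h2
  omega

theorem descendants_aiGraph (hG : IsRootedGraph G) (hv : IsVertical G o) (m : ℕ) (x : X) :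
    descendants (aiGraph G o Φ b γ) o m x = descendants G o m x := by
  ext y
  have e := fun z => level_aiGraph (Φ := Φ) (b := b) (γ := γ) hG hv z
  obtain ⟨w, hw⟩ := (aiGraph_connected (o := o) (Φ := Φ) (b := b) (γ := γ)
    hG).exists_walk_length_eq_dist x y
  have h1 := dist_le_of_aiGraph_walk hG hv w
  have h2 := level_le_of_aiGraph_walk hv w
  have h3 := aiGraph_dist_le (o := o) (Φ := Φ) (b := b) (γ := γ) hG x y
  have h4 := level_le_add_dist (o := o) hG x y
  have ex := e x
  have ey := e y
  simp only [descendants, Prec, Set.mem_ofPred_eq]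
  unfold level at *
  rw [ex, ey]
  constructor
  · rintro ⟨h5, h6⟩
    have := h1 (by omega)
    omega
  · rintro ⟨h5, h6⟩
    omega

theorem isRay_aiGraph_iff (hG : IsRootedGraph G) (hv : IsVertical G o) {x : ℕ → X} :
    IsRay (aiGraph G o Φ b γ) o x ↔ IsRay G o x := by
  simp only [IsRay, descendants_aiGraph hG hv]

theorem isRootedGraph_aiGraph (hG : IsRootedGraph G) (hv : IsVertical G o) :
    IsRootedGraph (aiGraph G o Φ b γ) where
  connected := aiGraph_connected hG
  locallyFinite x := by
    refine ((hG.locallyFinite x).union (finite_level_eq hG hv (level G o x))).subset ?_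
    rintro y (h | h)
    · exact Or.inl h
    · exact Or.inr h.1.symm

end AIGraph

/-! ### Index maps, expansiveness and the departing property -/

section IndexMap

variable {X M : Type*} [MetricSpace M] {G : SimpleGraph X} {o : X} {Φ : X → NonemptyCompacts M}
  {b γ : ℝ}

theorem setDist_le_dist {A B : Set M} {p q : M} (hp : p ∈ A) (hq : q ∈ B) :
    setDist A B ≤ dist p q := by
  refine csInf_le ⟨0, ?_⟩ (Set.mem_image2_of_mem hp hq)
  rintro _ ⟨p, -, q, -, rfl⟩
  exact dist_nonneg

theorem exists_dist_eq_setDist (A B : NonemptyCompacts M) :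
    ∃ p ∈ A, ∃ q ∈ B, dist p q = setDist (A : Set M) B := by
  have hne : (Set.image2 dist (A : Set M) (B : Set M)).Nonempty := A.nonempty.image2 B.nonempty
  have hc : IsCompact (Set.image2 dist (A : Set M) (B : Set M)) := by
    rw [← Set.image_prod]
    exact (A.isCompact.prod B.isCompact).image continuous_dist
  obtain ⟨p, hp, q, hq, h⟩ := hc.sInf_mem hne
  exact ⟨p, hp, q, hq, h⟩

theorem IsIndexMap.subset_of_prec (hΦ : IsIndexMap G o Φ) (hG : IsRootedGraph G)
    (hv : IsVertical G o) {x y : X} (h : Prec G o y x) : (Φ y : Set M) ⊆ Φ x :=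
  h.induction (P := fun x => (Φ y : Set M) ⊆ Φ x) hG hv subset_rfl
    fun x z hz hyz => hyz.trans (hΦ.subset x z hz)

/-- As there are only finitely many vertices on each level, the diameter estimate which defines
exponential type holds on all levels with the same constant. -/
theorem IsExponentialType.exists_dist_le (hexp : IsExponentialType G o Φ b)
    (hG : IsRootedGraph G) (hv : IsVertical G o) :
    ∃ C : ℝ, 0 < C ∧ ∀ x, ∀ p ∈ Φ x, ∀ q ∈ Φ x,
      dist p q ≤ C * Real.exp (-b * level G o x) := by
  obtain ⟨C, hC⟩ := hexp.bound
  rw [eventually_comap] at hC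
  obtain ⟨N, hN⟩ := eventually_atTop.1 hC
  obtain ⟨C', hC'⟩ := ((finite_level_lt (o := o) hG hv N).image fun x =>
    Metric.diam (Φ x : Set M) / Real.exp (-b * level G o x)).bddAbove
  refine ⟨max (max C C') 1, by positivity, fun x p hp q hq => ?_⟩
  refine (Metric.dist_le_diam_of_mem (Φ x).isCompact.isBounded hp hq).trans ?_
  by_cases hx : N ≤ level G o x
  · have h := hN _ hx x rfl
    rw [Real.norm_of_nonneg Metric.diam_nonneg, Real.norm_of_nonneg (Real.exp_pos _).le] at h
    refine h.trans ?_
    gcongr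
    exact (le_max_left _ _).trans (le_max_left _ _)
  · have h := hC' ⟨x, not_le.1 hx, rfl⟩
    rw [div_le_iff₀ (Real.exp_pos _)] at h
    refine h.trans ?_
    gcongr
    exact (le_max_right _ _).trans (le_max_left _ _)

theorem horizDist_aiGraph_le_one_iff (hG : IsRootedGraph G) (hv : IsVertical G o) (hγ : 0 ≤ γ)
    {x y : X} : horizDist (aiGraph G o Φ b γ) o x y ≤ 1 ↔
      level G o x = level G o y ∧
        setDist (Φ x : Set M) (Φ y) ≤ γ * Real.exp (-b * level G o x) := by
  rw [horizDist, SimpleGraph.edist_le_one_iff_adj_or_eq, horizontalPart_aiGraph_adj hG hv]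
  constructor
  · rintro (h | rfl)
    · exact ⟨h.1, h.2.2⟩
    · obtain ⟨p, hp⟩ := (Φ x).nonempty
      refine ⟨rfl, (setDist_le_dist hp hp).trans ?_⟩
      rw [dist_self]
      positivity
  · rintro ⟨h1, h2⟩
    by_cases h : x = y
    · exact Or.inr h
    · exact Or.inl ⟨h1, h, h2⟩

theorem isExpansive_aiGraph (hG : IsRootedGraph G) (hv : IsVertical G o)
    (hΦ : IsIndexMap G o Φ) (hb : 0 ≤ b) (hγ : 0 ≤ γ) : IsExpansive (aiGraph G o Φ b γ) o where
  rooted := isRootedGraph_aiGraph hG hv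
  expansive x y hxy u hu v hv' := by
    rw [descendants_aiGraph hG hv] at hu hv'
    contrapose! hxy
    rw [horizDist_aiGraph_le_one_iff hG hv hγ] at hxy ⊢
    obtain ⟨h1, h2⟩ := hxy
    have hu2 := hu.2
    have hv2 := hv'.2
    refine ⟨by omega, ?_⟩
    obtain ⟨p, hp, q, hq, hpq⟩ := exists_dist_eq_setDist (Φ u) (Φ v)
    refine (setDist_le_dist (hΦ.subset x u hu hp) (hΦ.subset y v hv' hq)).trans ?_
    rw [hpq]
    refine h2.trans ?_
    refine mul_le_mul_of_nonneg_left (Real.exp_le_exp.2 ?_) hγ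
    have : (level G o u : ℝ) = level G o x + 1 := by exact_mod_cast hu2
    nlinarith

/-- If `u`, `v` are descendants of `x`, `y` of generation `m` at horizontal distance at most `2`,
then `Φ u` and `Φ v` have a distance of at most a constant times `e^{-b (|x| + m)}`, hence the
larger sets `Φ x`, `Φ y` have a distance of at most `γ e^{-b |x|}` as soon as `m` is large. -/
theorem exists_isDeparting_aiGraph (hG : IsRootedGraph G) (hv : IsVertical G o)
    (hΦ : IsIndexMap G o Φ) (hb : 0 < b) (hexp : IsExponentialType G o Φ b) (hγ : 0 < γ) :
    ∃ m : ℕ, 1 ≤ m ∧ IsDeparting (aiGraph G o Φ b γ) o m 1 := by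
  obtain ⟨C, hC, hdist⟩ := hexp.exists_dist_le hG hv
  have hlim : Tendsto (fun m : ℕ => (2 * γ + C) * Real.exp (-b * m)) atTop (𝓝 0) := by
    have h1 : Tendsto (fun m : ℕ => b * (m : ℝ)) atTop atTop :=
      tendsto_natCast_atTop_atTop.const_mul_atTop hb
    have := (Real.tendsto_exp_neg_atTop_nhds_zero.comp h1).const_mul (2 * γ + C)
    simpa [Function.comp_def] using this
  obtain ⟨m, hm, hm1⟩ := ((hlim.eventually_lt_const hγ).and (eventually_ge_atTop 1)).exists
  refine ⟨m, hm1, fun x y hxy u hu v hv' => ?_⟩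
  rw [descendants_aiGraph hG hv] at hu hv'
  by_contra hcon
  rw [not_lt] at hcon
  refine absurd hxy (not_lt.2 ?_)
  rw [Nat.cast_one, horizDist_aiGraph_le_one_iff hG hv hγ.le]
  -- A walk of length at most `2` has a middle vertex `w`, which may be one of its ends.
  obtain ⟨w, hw1, hw2⟩ : ∃ w, horizDist (aiGraph G o Φ b γ) o u w ≤ 1 ∧
      horizDist (aiGraph G o Φ b γ) o w v ≤ 1 := by
    have hne : (horizontalPart (aiGraph G o Φ b γ) o).edist u v ≠ ⊤ := by
      intro h
      rw [horizDist, h] at hcon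
      exact absurd (top_le_iff.1 hcon) (by norm_num)
    obtain ⟨p, hp⟩ := SimpleGraph.exists_walk_of_edist_ne_top hne
    have hlen : p.length ≤ 2 := by
      rw [horizDist, ← hp] at hcon
      norm_num at hcon
      exact_mod_cast hcon
    cases p with
    | nil => exact ⟨u, by simp [horizDist], by simp [horizDist]⟩
    | @cons _ w _ h p =>
      refine ⟨w, SimpleGraph.edist_le_one_iff_adj_or_eq.2 (Or.inl h),
        (SimpleGraph.edist_le p).trans ?_⟩
      rw [SimpleGraph.Walk.length_cons] at hlen
      exact_mod_cast (by omega : p.length ≤ 1)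
  rw [horizDist_aiGraph_le_one_iff hG hv hγ.le] at hw1 hw2
  have hu2 := hu.2
  have hv2 := hv'.2
  refine ⟨by omega, ?_⟩
  obtain ⟨p, hp, q, hq, hpq⟩ := exists_dist_eq_setDist (Φ u) (Φ w)
  obtain ⟨q', hq', r, hr, hqr⟩ := exists_dist_eq_setDist (Φ w) (Φ v)
  refine (setDist_le_dist (hΦ.subset_of_prec hG hv hu.1 hp)
    (hΦ.subset_of_prec hG hv hv'.1 hr)).trans ?_
  have h1 := hw1.2
  have h2 := hw2.2
  have h3 := hdist w q hq q' hq'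
  rw [← hpq] at h1
  rw [← hqr, ← hw1.1] at h2
  rw [← hw1.1] at h3
  have e : Real.exp (-b * level G o u) = Real.exp (-b * m) * Real.exp (-b * level G o x) := by
    rw [← Real.exp_add, hu2]
    push_cast
    ring_nf
  rw [e] at h1 h2 h3
  have h4 := dist_triangle4 p q q' r
  have h5 := mul_le_mul_of_nonneg_right hm.le (Real.exp_pos (-b * level G o x)).le
  linarith

end IndexMap

/-! ### The Gromov product of the `AI_b`-graph -/

section GromovProduct

variable {X M : Type*} [MetricSpace M] {G : SimpleGraph X} {o : X} {Φ : X → NonemptyCompacts M}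
  {b γ : ℝ} {f : X → M}

theorem gromovProduct_nonneg {T : SimpleGraph X} (hT : T.Connected) (o x y : X) :
    0 ≤ gromovProduct T o x y := by
  have h : T.dist x y ≤ T.dist o x + T.dist o y := by
    rw [T.dist_comm (u := o) (v := x)]
    exact hT.dist_triangle
  have h' : (T.dist x y : ℝ) ≤ T.dist o x + T.dist o y := by exact_mod_cast h
  unfold gromovProduct level
  linarith

theorem gromovProduct_le_left {T : SimpleGraph X} (hT : T.Connected) (o x y : X) :
    gromovProduct T o x y ≤ level T o x := by
  have h : T.dist o y ≤ T.dist o x + T.dist x y := hT.dist_triangle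
  have h' : (T.dist o y : ℝ) ≤ T.dist o x + T.dist x y := by exact_mod_cast h
  unfold gromovProduct level
  linarith

theorem gromovProduct_self (T : SimpleGraph X) (o x : X) :
    gromovProduct T o x x = level T o x := by
  simp [gromovProduct]

/-- The function `e^{-b|x|} + e^{-b|y|} + ρ(f x, f y)` of two vertices, where `f` is a choice of
points `f x ∈ Φ x`. It satisfies the triangle inequality, and it does not refer to the edges of the
`AI_b`-graph. -/
noncomputable def levelDist (G : SimpleGraph X) (o : X) (b : ℝ) (f : X → M) (x y : X) : ℝ :=
  Real.exp (-b * level G o x) + Real.exp (-b * level G o y) + dist (f x) (f y)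

theorem levelDist_pos (G : SimpleGraph X) (o : X) (b : ℝ) (f : X → M) (x y : X) :
    0 < levelDist G o b f x y := by
  unfold levelDist
  positivity

theorem levelDist_triangle (G : SimpleGraph X) (o : X) (b : ℝ) (f : X → M) (x y z : X) :
    levelDist G o b f x y ≤ levelDist G o b f x z + levelDist G o b f z y := by
  unfold levelDist
  have := dist_triangle (f x) (f z) (f y)
  have := Real.exp_pos (-b * level G o z)
  linarith

theorem dist_le_of_aiGraph_adj (hv : IsVertical G o) (hΦ : IsIndexMap G o Φ) (hb : 0 < b) {C : ℝ}
    (hC : 0 ≤ C) (hdist : ∀ x, ∀ p ∈ Φ x, ∀ q ∈ Φ x, dist p q ≤ C * Real.exp (-b * level G o x))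
    (hγ : 0 ≤ γ) {x y : X} (h : (aiGraph G o Φ b γ).Adj x y) {p q : M} (hp : p ∈ Φ x)
    (hq : q ∈ Φ y) :
    dist p q ≤ (2 * C * Real.exp b + γ) * Real.exp (-b * level G o x) := by
  have hE := Real.exp_pos (-b * level G o x)
  have hb1 : 1 ≤ Real.exp b := Real.one_le_exp hb.le
  have hCE : 0 ≤ C * Real.exp (-b * level G o x) := by positivity
  have hγE : 0 ≤ γ * Real.exp (-b * level G o x) := by positivity
  have hCb := mul_le_mul_of_nonneg_right hb1 hCE
  rcases h with h | ⟨hl, -, h⟩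
  · rcases hv.level_eq_or h with hl | hl
    · have h1 := hdist y p (hΦ.subset y x (mem_descendants_one_iff.2 ⟨h.symm, hl⟩) hp) q hq
      have e : Real.exp (-b * level G o y) = Real.exp b * Real.exp (-b * level G o x) := by
        rw [← Real.exp_add, hl]
        push_cast
        ring_nf
      rw [e] at h1
      nlinarith
    · have h1 := hdist x p hp q (hΦ.subset x y (mem_descendants_one_iff.2 ⟨h, hl⟩) hq)
      nlinarith
  · obtain ⟨p', hp', q', hq', he⟩ := exists_dist_eq_setDist (Φ x) (Φ y)
    have h1 := hdist x p hp p' hp'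
    have h2 := hdist y q' hq' q hq
    rw [← hl] at h2
    rw [← he] at h
    have := dist_triangle4 p p' q' q
    nlinarith

/-- As the level drops by at most one at each step, the contributions of the edges of a walk are
bounded by a geometric series. -/
theorem dist_le_of_aiGraph_walk_of_adj (hv : IsVertical G o) (hb : 0 < b) {C : ℝ} (hC : 0 ≤ C)
    (hadj : ∀ x y, (aiGraph G o Φ b γ).Adj x y →
      dist (f x) (f y) ≤ C * Real.exp (-b * level G o x))
    {x y : X} (w : (aiGraph G o Φ b γ).Walk x y) :
    dist (f x) (f y) ≤ C / (Real.exp b - 1) * ((Real.exp (b * w.length) - 1) *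
      Real.exp (-b * level G o x)) := by
  have hb1 : 0 < Real.exp b - 1 := sub_pos.2 (Real.one_lt_exp_iff.2 hb)
  induction w with
  | nil => simp
  | @cons x z y h w ih =>
    have h1 : level G o x ≤ level G o z + 1 := level_le_of_aiGraph_adj hv h.symm
    have h2 : Real.exp (-b * level G o z) ≤ Real.exp b * Real.exp (-b * level G o x) := by
      rw [← Real.exp_add, Real.exp_le_exp]
      have : (level G o x : ℝ) ≤ level G o z + 1 := by exact_mod_cast h1
      nlinarith
    have h3 : 0 ≤ Real.exp (b * w.length) - 1 :=
      sub_nonneg.2 (Real.one_le_exp (by positivity))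
    have e : Real.exp (b * (w.cons h).length) = Real.exp b * Real.exp (b * w.length) := by
      rw [← Real.exp_add, SimpleGraph.Walk.length_cons]
      push_cast
      ring_nf
    calc dist (f x) (f y) ≤ dist (f x) (f z) + dist (f z) (f y) := dist_triangle _ _ _
      _ ≤ C * Real.exp (-b * level G o x) + C / (Real.exp b - 1) *
          ((Real.exp (b * w.length) - 1) * (Real.exp b * Real.exp (-b * level G o x))) := by
        refine add_le_add (hadj x z h) (ih.trans ?_)
        gcongr
      _ = _ := by
        rw [e]
        field_simp
        ring

/-- Splitting a geodesic from `x` to `y` at its point closest to the root, whose level is about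
`(x|y)`, gives the bound from above for `levelDist`. -/
theorem exists_levelDist_le (hG : IsRootedGraph G) (hv : IsVertical G o) (hΦ : IsIndexMap G o Φ)
    (hb : 0 < b) (hexp : IsExponentialType G o Φ b) (hγ : 0 ≤ γ) (hf : ∀ x, f x ∈ Φ x) :
    ∃ c : ℝ, ∀ x y, levelDist G o b f x y ≤
      c * Real.exp (-b * gromovProduct (aiGraph G o Φ b γ) o x y) := by
  obtain ⟨C, hC, hdist⟩ := hexp.exists_dist_le hG hv
  have hT : (aiGraph G o Φ b γ).Connected := aiGraph_connected hG
  have hC3 : 0 ≤ 2 * C * Real.exp b + γ := by positivity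
  have hwalk := fun x y (w : (aiGraph G o Φ b γ).Walk x y) =>
    dist_le_of_aiGraph_walk_of_adj (f := f) hv hb hC3 (fun x y h =>
      dist_le_of_aiGraph_adj hv hΦ hb hC.le hdist hγ h (hf x) (hf y)) w
  set A := (2 * C * Real.exp b + γ) / (Real.exp b - 1) with hA
  have hA0 : 0 ≤ A := div_nonneg hC3 (sub_pos.2 (Real.one_lt_exp_iff.2 hb)).le
  refine ⟨2 + A * (1 + Real.exp b), fun x y => ?_⟩
  have hx := gromovProduct_le_left hT o x y
  have hy := gromovProduct_le_left hT o y x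
  rw [gromovProduct_comm] at hy
  rw [level_aiGraph hG hv] at hx hy
  obtain ⟨w, hw⟩ := hT.exists_walk_length_eq_dist x y
  have hg : gromovProduct (aiGraph G o Φ b γ) o x y =
      ((level G o x : ℝ) + level G o y - w.length) / 2 := by
    rw [gromovProduct, level_aiGraph hG hv, level_aiGraph hG hv, hw]
  set g := gromovProduct (aiGraph G o Φ b γ) o x y with hgdef
  obtain ⟨n, hn⟩ : ∃ n, n = (level G o x + w.length - level G o y) / 2 := ⟨_, rfl⟩
  have hl1 := level_le_of_aiGraph_walk hv w
  have hl2 := level_le_of_aiGraph_walk hv w.reverse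
  rw [SimpleGraph.Walk.length_reverse] at hl2
  have hnL : n ≤ w.length := by omega
  have h1 := hwalk _ _ (w.take n)
  have h2 := hwalk _ _ (w.drop n).reverse
  rw [SimpleGraph.Walk.take_length, min_eq_left hnL] at h1
  rw [SimpleGraph.Walk.length_reverse, SimpleGraph.Walk.drop_length, Nat.cast_sub hnL] at h2
  have hn1 : 2 * (n : ℝ) ≤ level G o x + w.length - level G o y := by
    have : 2 * n + level G o y ≤ level G o x + w.length := by omega
    have : 2 * (n : ℝ) + level G o y ≤ level G o x + w.length := by exact_mod_cast this
    linarith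
  have hn2 : (level G o x : ℝ) + w.length - level G o y ≤ 2 * n + 2 := by
    have : level G o x + w.length ≤ 2 * n + 2 + level G o y := by omega
    have : (level G o x : ℝ) + w.length ≤ 2 * n + 2 + level G o y := by exact_mod_cast this
    linarith
  have h1' : (Real.exp (b * n) - 1) * Real.exp (-b * level G o x) ≤ Real.exp (-b * g) := by
    have : Real.exp (b * n) * Real.exp (-b * level G o x) ≤ Real.exp (-b * g) := by
      rw [← Real.exp_add, Real.exp_le_exp]
      nlinarith
    have := Real.exp_pos (-b * level G o x)
    linarith
  have h2' : (Real.exp (b * (w.length - n)) - 1) * Real.exp (-b * level G o y) ≤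
      Real.exp b * Real.exp (-b * g) := by
    have : Real.exp (b * (w.length - n)) * Real.exp (-b * level G o y) ≤
        Real.exp b * Real.exp (-b * g) := by
      rw [← Real.exp_add, ← Real.exp_add, Real.exp_le_exp]
      nlinarith
    have := Real.exp_pos (-b * level G o y)
    linarith
  have h3 := dist_triangle_right (f x) (f y) (f (w.getVert n))
  have h4 := h1.trans (mul_le_mul_of_nonneg_left h1' hA0)
  have h5 := h2.trans (mul_le_mul_of_nonneg_left h2' hA0)
  have h6 : Real.exp (-b * level G o x) ≤ Real.exp (-b * g) := Real.exp_le_exp.2 (by nlinarith)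
  have h7 : Real.exp (-b * level G o y) ≤ Real.exp (-b * g) := Real.exp_le_exp.2 (by nlinarith)
  unfold levelDist
  linarith

theorem sub_half_le_gromovProduct_aiGraph (hG : IsRootedGraph G) (hv : IsVertical G o)
    (hΦ : IsIndexMap G o Φ) (hγ : 0 ≤ γ) {x y : X} {p q : M} (hp : p ∈ Φ x) (hq : q ∈ Φ y) {n : ℕ}
    (hnx : n ≤ level G o x) (hny : n ≤ level G o y) (h : dist p q ≤ γ * Real.exp (-b * n)) :
    (n : ℝ) - 1 / 2 ≤ gromovProduct (aiGraph G o Φ b γ) o x y := by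
  obtain ⟨x', hx', rfl⟩ := exists_prec_level_eq hG hv x hnx
  obtain ⟨y', hy', hl⟩ := exists_prec_level_eq hG hv y hny
  have h1 : horizDist (aiGraph G o Φ b γ) o x' y' ≤ 1 :=
    (horizDist_aiGraph_le_one_iff hG hv hγ).2 ⟨hl.symm, (setDist_le_dist
      (hΦ.subset_of_prec hG hv hx' hp) (hΦ.subset_of_prec hG hv hy' hq)).trans h⟩
  have h2 : (aiGraph G o Φ b γ).dist x' y' ≤ 1 := by
    rcases SimpleGraph.edist_le_one_iff_adj_or_eq.1 h1 with h1 | rfl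
    · exact (SimpleGraph.dist_eq_one_iff_adj.2 h1.1).le
    · simp
  have hT : (aiGraph G o Φ b γ).Connected := aiGraph_connected hG
  have h3 := hT.dist_triangle (u := x) (v := x') (w := y)
  have h4 := hT.dist_triangle (u := x') (v := y') (w := y)
  have h5 := aiGraph_dist_le (o := o) (Φ := Φ) (b := b) (γ := γ) hG x' x
  have h6 := aiGraph_dist_le (o := o) (Φ := Φ) (b := b) (γ := γ) hG y' y
  have h7 : level G o x' + G.dist x' x = level G o x := hx'
  have h8 : level G o y' + G.dist y' y = level G o y := hy'
  rw [SimpleGraph.dist_comm (u := x') (v := x)] at h5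
  have h9 : (aiGraph G o Φ b γ).dist x y + 2 * level G o x' ≤ level G o x + level G o y + 1 := by
    omega
  have h9' : ((aiGraph G o Φ b γ).dist x y : ℝ) + 2 * level G o x' ≤
    level G o x + level G o y + 1 := by exact_mod_cast h9
  rw [gromovProduct, level_aiGraph hG hv, level_aiGraph hG hv]
  linarith

/-- The ancestors of `x` and `y` are equal or neighbours down to the last level `n` for which
`ρ(f x, f y) ≤ γ e^{-b n}`; this gives the bound from below for `levelDist`. -/
theorem exists_exp_gromovProduct_le (hG : IsRootedGraph G) (hv : IsVertical G o)
    (hΦ : IsIndexMap G o Φ) (hb : 0 < b) (hγ : 0 < γ) (hf : ∀ x, f x ∈ Φ x) :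
    ∃ c : ℝ, ∀ x y, Real.exp (-b * gromovProduct (aiGraph G o Φ b γ) o x y) ≤
      c * levelDist G o b f x y := by
  classical
  refine ⟨Real.exp b * (1 + Real.exp b / γ), fun x y => ?_⟩
  have hT : (aiGraph G o Φ b γ).Connected := aiGraph_connected hG
  have hbase : ∀ {n : ℕ}, n ≤ level G o x → n ≤ level G o y →
      dist (f x) (f y) ≤ γ * Real.exp (-b * n) →
      Real.exp (-b * gromovProduct (aiGraph G o Φ b γ) o x y) ≤
        Real.exp b * Real.exp (-b * n) := by
    intro n h1 h2 h3
    have := sub_half_le_gromovProduct_aiGraph hG hv hΦ hγ.le (hf x) (hf y) h1 h2 h3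
    rw [← Real.exp_add, Real.exp_le_exp]
    nlinarith
  have hx := Real.exp_pos (-b * level G o x)
  have hy := Real.exp_pos (-b * level G o y)
  have hr := dist_nonneg (x := f x) (y := f y)
  have hbb := Real.exp_pos b
  have hb1 : 1 ≤ Real.exp b := Real.one_le_exp hb.le
  have hD1 : Real.exp (-b * (min (level G o x) (level G o y) : ℕ)) ≤ levelDist G o b f x y := by
    unfold levelDist
    rcases min_choice (level G o x) (level G o y) with h | h <;> rw [h] <;> linarith
  have hD2 : dist (f x) (f y) ≤ levelDist G o b f x y := by
    unfold levelDist
    linarith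
  have hD := levelDist_pos G o b f x y
  by_cases h : ∃ n : ℕ, n ≤ min (level G o x) (level G o y) ∧
      γ * Real.exp (-b * n) < dist (f x) (f y)
  · obtain ⟨hn1, hn2⟩ := Nat.find_spec h
    have hmin := fun {m} (hm : m < Nat.find h) => Nat.find_min h hm
    rcases hk : Nat.find h with _ | k
    · -- Here `n = 0` already fails, and `(x|y) ≥ 0` is enough.
      rw [hk] at hn2
      have h0 : Real.exp (-b * gromovProduct (aiGraph G o Φ b γ) o x y) ≤ 1 := by
        rw [Real.exp_le_one_iff]
        have := gromovProduct_nonneg hT o x y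
        nlinarith
      have hγD : 1 ≤ levelDist G o b f x y / γ := by
        rw [one_le_div hγ]
        simp only [CharP.cast_eq_zero, mul_zero, Real.exp_zero, mul_one] at hn2
        linarith
      calc _ ≤ (1 : ℝ) := h0
        _ ≤ (Real.exp b * Real.exp b) * (levelDist G o b f x y / γ) := by nlinarith
        _ ≤ (Real.exp b * Real.exp b) * (levelDist G o b f x y / γ) +
            Real.exp b * levelDist G o b f x y := by
          have : 0 < Real.exp b * levelDist G o b f x y := by positivity
          linarith
        _ = _ := by ring
    · rw [hk] at hn1 hn2 hmin
      have hk1 := hmin (Nat.lt_succ_self k)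
      have hk2 : dist (f x) (f y) ≤ γ * Real.exp (-b * k) := by
        by_contra hcon
        exact hk1 ⟨by omega, not_le.1 hcon⟩
      have h1 := hbase (n := k) (by omega) (by omega) hk2
      have h2 : Real.exp (-b * k) ≤ Real.exp b * (levelDist G o b f x y / γ) := by
        have e : Real.exp (-b * k) = Real.exp b * Real.exp (-b * (k + 1 : ℕ)) := by
          rw [← Real.exp_add]
          push_cast
          ring_nf
        rw [e]
        gcongr
        rw [le_div_iff₀ hγ]
        linarith
      calc _ ≤ Real.exp b * Real.exp (-b * k) := h1
        _ ≤ Real.exp b * (Real.exp b * (levelDist G o b f x y / γ)) := by gcongr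
        _ ≤ Real.exp b * (Real.exp b * (levelDist G o b f x y / γ)) +
            Real.exp b * levelDist G o b f x y := by
          have : 0 < Real.exp b * levelDist G o b f x y := by positivity
          linarith
        _ = _ := by ring
  · have h1 := hbase (min_le_left _ _) (min_le_right _ _)
      (not_lt.1 fun hcon => h ⟨_, le_rfl, hcon⟩)
    calc _ ≤ _ := h1
      _ ≤ Real.exp b * levelDist G o b f x y := by gcongr
      _ ≤ Real.exp b * levelDist G o b f x y +
          Real.exp b * (Real.exp b * (levelDist G o b f x y / γ)) := by
        have : 0 < Real.exp b * (Real.exp b * (levelDist G o b f x y / γ)) := by positivity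
        linarith
      _ = _ := by ring

/-- A function comparable with `e^{-b(x|y)}` which satisfies the triangle inequality gives
hyperbolicity. -/
theorem isHyperbolic_of_triangle {T : SimpleGraph X} {o : X} (hb : 0 < b) {D : X → X → ℝ}
    (hD : ∀ x y z, D x y ≤ D x z + D z y) {c c' : ℝ}
    (h1 : ∀ x y, D x y ≤ c * Real.exp (-b * gromovProduct T o x y))
    (h2 : ∀ x y, Real.exp (-b * gromovProduct T o x y) ≤ c' * D x y) (hc' : 0 ≤ c') :
    IsHyperbolic T o := by
  set k := max (2 * c' * c) 1 with hk
  have hk1 : 1 ≤ k := le_max_right _ _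
  refine ⟨Real.log k / b, div_nonneg (Real.log_nonneg hk1) hb.le, fun x y z => ?_⟩
  set m := min (gromovProduct T o x z) (gromovProduct T o z y) with hm
  have hxz : Real.exp (-b * gromovProduct T o x z) ≤ Real.exp (-b * m) :=
    Real.exp_le_exp.2 (by nlinarith [min_le_left (gromovProduct T o x z) (gromovProduct T o z y)])
  have hzy : Real.exp (-b * gromovProduct T o z y) ≤ Real.exp (-b * m) :=
    Real.exp_le_exp.2 (by nlinarith [min_le_right (gromovProduct T o x z) (gromovProduct T o z y)])
  have hc : 0 ≤ c' * c := by
    have := (h2 x x).trans (mul_le_mul_of_nonneg_left (h1 x x) hc')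
    rw [← mul_assoc] at this
    have hp := Real.exp_pos (-b * gromovProduct T o x x)
    by_contra hcon
    nlinarith
  have key : Real.exp (-b * gromovProduct T o x y) ≤ k * Real.exp (-b * m) := by
    calc _ ≤ c' * D x y := h2 x y
      _ ≤ c' * (c * Real.exp (-b * gromovProduct T o x z) +
          c * Real.exp (-b * gromovProduct T o z y)) := by
        gcongr
        exact (hD x y z).trans (add_le_add (h1 x z) (h1 z y))
      _ = (c' * c) * Real.exp (-b * gromovProduct T o x z) +
          (c' * c) * Real.exp (-b * gromovProduct T o z y) := by ring
      _ ≤ (c' * c) * Real.exp (-b * m) + (c' * c) * Real.exp (-b * m) := by gcongr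
      _ = 2 * c' * c * Real.exp (-b * m) := by ring
      _ ≤ _ := by
        gcongr
        exact le_max_left _ _
  have hk0 : 0 < k := by linarith
  rw [← Real.exp_log hk0, ← Real.exp_add, Real.exp_le_exp] at key
  have e : Real.log k / b * b = Real.log k := div_mul_cancel₀ _ hb.ne'
  by_contra hcon
  rw [not_le] at hcon
  have := mul_lt_mul_of_pos_right hcon hb
  rw [sub_mul, e] at this
  linarith

end GromovProduct

/-! ### The Gromov metric -/

section GromovMetric

variable {X : Type*} {T : SimpleGraph X} {o : X} {a : ℝ}

theorem theta_le_exp (T : SimpleGraph X) (o : X) (a : ℝ) (x y : X) :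
    theta T o a x y ≤ Real.exp (-a * gromovProduct T o x y) :=
  theta_le ⟨1, le_rfl, fun i => if i = 0 then x else y, by simp, by simp, by simp⟩

/-- The quasimetric `e^{-a(x|y)}` satisfies the ultrametric inequality with the factor
`e^{δa} < √2`, hence the ultrametric inequality for three steps with the factor `2`. So Frink's
metrization lemma applies: `e^{-a(x|y)}` is at most twice the sum of `e^{-a(z_i|z_{i+1})}` over any
chain from `x` to `y`. -/
theorem exp_le_two_mul_theta (ha : IsGromovParameter T o a) {x y : X} (hxy : x ≠ y) :
    Real.exp (-a * gromovProduct T o x y) ≤ 2 * theta T o a x y := by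
  classical
  obtain ⟨ha0, δ, hδ, hyp, hsqrt⟩ := ha
  let d : X → X → NNReal := fun x y =>
    if x = y then 0 else (Real.exp (-a * gromovProduct T o x y)).toNNReal
  have d_self : ∀ x, d x x = 0 := fun x => if_pos rfl
  have d_coe : ∀ {x y}, x ≠ y → (d x y : ℝ) = Real.exp (-a * gromovProduct T o x y) := by
    intro x y h
    simp only [d, if_neg h, Real.coe_toNNReal _ (Real.exp_pos _).le]
  have d_le : ∀ x y, (d x y : ℝ) ≤ Real.exp (-a * gromovProduct T o x y) := by
    intro x y
    by_cases h : x = y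
    · subst h
      rw [d_self]
      exact (Real.exp_pos _).le
    · exact (d_coe h).le
  have d_comm : ∀ x y, d x y = d y x := by
    intro x y
    simp only [d, eq_comm (a := x) (b := y), gromovProduct_comm T o x y]
  set K : ℝ := Real.exp (δ * a) with hK
  have hK1 : 1 ≤ K := Real.one_le_exp (by positivity)
  have hK2 : K * K ≤ 2 := by
    have := Real.mul_self_sqrt (show (0 : ℝ) ≤ 2 by norm_num)
    nlinarith
  have d_ultra : ∀ x y z, (d x y : ℝ) ≤ K * max (d x z : ℝ) (d z y) := by
    intro x y z
    have hm : 0 ≤ max (d x z : ℝ) (d z y) := le_max_of_le_left (d x z).2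
    by_cases hxy : x = y
    · subst hxy
      rw [d_self]
      exact mul_nonneg (by linarith) hm
    by_cases hxz : x = z
    · subst hxz
      calc (d x y : ℝ) ≤ max (d x x : ℝ) (d x y) := le_max_right _ _
        _ ≤ _ := le_mul_of_one_le_left hm hK1
    by_cases hzy : z = y
    · subst hzy
      calc (d x z : ℝ) ≤ max (d x z : ℝ) (d z z) := le_max_left _ _
        _ ≤ _ := le_mul_of_one_le_left hm hK1
    have h := hyp x y z
    rw [d_coe hxy, d_coe hxz, d_coe hzy]
    rcases min_choice (gromovProduct T o x z) (gromovProduct T o z y) with hc | hc <;>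
      rw [hc] at h
    · refine le_trans ?_ (mul_le_mul_of_nonneg_left (le_max_left _ _) (by linarith))
      rw [hK, ← Real.exp_add, Real.exp_le_exp]
      nlinarith
    · refine le_trans ?_ (mul_le_mul_of_nonneg_left (le_max_right _ _) (by linarith))
      rw [hK, ← Real.exp_add, Real.exp_le_exp]
      nlinarith
  have hd : ∀ x₁ x₂ x₃ x₄, d x₁ x₄ ≤ 2 * max (d x₁ x₂) (max (d x₂ x₃) (d x₃ x₄)) := by
    intro x₁ x₂ x₃ x₄
    rw [← NNReal.coe_le_coe]
    push_cast
    have h1 := d_ultra x₁ x₄ x₂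
    have h2 := d_ultra x₂ x₄ x₃
    set m := max (d x₂ x₃ : ℝ) (d x₃ x₄)
    have hm : 0 ≤ m := le_max_of_le_left (d x₂ x₃).2
    have h3 : max (d x₁ x₂ : ℝ) (d x₂ x₄) ≤ K * max (d x₁ x₂ : ℝ) m := by
      refine max_le ?_ ?_
      · exact (le_max_left _ _).trans (le_mul_of_one_le_left (le_max_of_le_right hm) hK1)
      · refine h2.trans ?_
        gcongr
        exact le_max_right _ _
    calc (d x₁ x₄ : ℝ) ≤ K * (K * max (d x₁ x₂ : ℝ) m) :=
          h1.trans (mul_le_mul_of_nonneg_left h3 (by linarith))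
      _ = (K * K) * max (d x₁ x₂ : ℝ) m := by ring
      _ ≤ _ := mul_le_mul_of_nonneg_right hK2 (le_max_of_le_right hm)
  let _ : PseudoMetricSpace X := PseudoMetricSpace.ofPreNNDist d d_self d_comm
  have hdist : ∀ x y : X, dist x y ≤ d x y :=
    PseudoMetricSpace.dist_ofPreNNDist_le d d_self d_comm
  have hle : (d x y : ℝ) ≤ 2 * dist x y :=
    PseudoMetricSpace.le_two_mul_dist_ofPreNNDist d d_self d_comm hd x y
  rw [d_coe hxy] at hle
  refine hle.trans (mul_le_mul_of_nonneg_left ?_ (by norm_num))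
  rw [theta, if_neg hxy]
  refine le_csInf (chainSums_nonempty T o a x y) ?_
  rintro _ ⟨n, -, z, rfl, rfl, rfl⟩
  exact (dist_le_range_sum_dist z n).trans
    (Finset.sum_le_sum fun i _ => (hdist _ _).trans (d_le _ _))

/-- A form of the lower bound for the Gromov metric without exceptional pairs: if `x = y`, then
`(x|y) = |x|`. -/
theorem exp_le_two_mul_theta_add (ha : IsGromovParameter T o a) (x y : X) :
    Real.exp (-a * gromovProduct T o x y) ≤
      2 * theta T o a x y + Real.exp (-a * level T o x) := by
  by_cases h : x = y
  · subst h
    rw [gromovProduct_self]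
    have := theta_nonneg T o a x x
    linarith
  · have := exp_le_two_mul_theta ha h
    have := Real.exp_pos (-a * level T o x)
    linarith

theorem dist_toCompletion (T : SimpleGraph X) (o : X) (a : ℝ) (x y : X) :
    dist (toCompletion T o a x) (toCompletion T o a y) = theta T o a x y :=
  UniformSpace.Completion.dist_eq (α := GromovSpace T o a) x y

theorem exists_vertices_convergesTo (T : SimpleGraph X) (o : X) (a : ℝ)
    (ξ : GromovCompletion T o a) : ∃ v : ℕ → X, ConvergesTo T o a v ξ := by
  have h : DenseRange (toCompletion T o a) :=
    UniformSpace.Completion.denseRange_coe (α := GromovSpace T o a)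
  obtain ⟨u, hu, hlim⟩ := mem_closure_iff_seq_limit.1 (h.closure_range ▸ Set.mem_univ ξ)
  choose v hv using hu
  refine ⟨v, ?_⟩
  unfold ConvergesTo
  simpa only [hv] using hlim

/-- If a sequence of vertices converges to a boundary point, it leaves each vertex eventually. -/
theorem ConvergesTo.eventually_ne {v : ℕ → X} {ξ : boundary T o a} (h : ConvergesTo T o a v ξ)
    (x : X) : ∀ᶠ j in atTop, v j ≠ x := by
  by_contra hcon
  rw [not_eventually] at hcon
  refine ξ.2 ⟨x, ?_⟩
  by_contra hne
  have h1 : ∀ᶠ j in atTop, toCompletion T o a (v j) ≠ toCompletion T o a x :=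
    h.eventually (isOpen_ne.mem_nhds (Ne.symm hne))
  obtain ⟨j, hj, hj'⟩ := (hcon.and_eventually h1).exists
  exact hj' (by rw [not_not.1 hj])

/-- If the levels of the vertices of a converging sequence tend to infinity, the limit is a boundary
point, as `θ_a(x, y) ≥ e^{-a|x|} / 2` for all `y ≠ x`. -/
theorem ConvergesTo.mem_boundary (hT : T.Connected) (ha : IsGromovParameter T o a) {v : ℕ → X}
    {ξ : GromovCompletion T o a} (h : ConvergesTo T o a v ξ)
    (hv : Tendsto (fun j => level T o (v j)) atTop atTop) : ξ ∈ boundary T o a := by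
  rintro ⟨x, rfl⟩
  have h1 : Tendsto (fun j => dist (toCompletion T o a (v j)) (toCompletion T o a x)) atTop
      (𝓝 0) := tendsto_iff_dist_tendsto_zero.1 h
  have h2 := h1.eventually_lt_const
    (show 0 < Real.exp (-a * level T o x) / 2 by positivity)
  obtain ⟨j, hj1, hj2⟩ := (h2.and (hv.eventually_gt_atTop (level T o x))).exists
  rw [dist_toCompletion, theta_comm] at hj1
  have hne : x ≠ v j := by
    rintro rfl
    exact lt_irrefl _ hj2
  have h3 := exp_le_two_mul_theta ha hne
  have h4 := gromovProduct_le_left hT o x (v j)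
  have h5 : Real.exp (-a * level T o x) ≤ Real.exp (-a * gromovProduct T o x (v j)) :=
    Real.exp_le_exp.2 (by nlinarith [ha.1])
  linarith

end GromovMetric

/-! ### Rays, boundary points and the attractor -/

section Boundary

variable {X M : Type*} [MetricSpace M] {G : SimpleGraph X} {o : X} {Φ : X → NonemptyCompacts M}
  {a b γ : ℝ} {f : X → M}

theorem IsRay.prec (hG : IsRootedGraph G) {x : ℕ → X} (hx : IsRay G o x) {i j : ℕ} (hij : i ≤ j) :
    Prec G o (x j) (x i) := by
  obtain ⟨k, rfl⟩ := Nat.exists_eq_add_of_le hij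
  have h1 := hx.dist_le hG i k
  have h2 := level_le_add_dist (o := o) hG (x i) (x (i + k))
  have h3 := hx.level_eq i
  have h4 := hx.level_eq (i + k)
  unfold level at *
  unfold Prec
  omega

theorem Prec.level_le_gromovProduct_aiGraph (hG : IsRootedGraph G) (hv : IsVertical G o) {x y : X}
    (h : Prec G o y x) :
    (level G o x : ℝ) ≤ gromovProduct (aiGraph G o Φ b γ) o x y := by
  have h1 := aiGraph_dist_le (o := o) (Φ := Φ) (b := b) (γ := γ) hG x y
  have h2 : level G o x + G.dist x y = level G o y := h
  have h3 : level G o x + (aiGraph G o Φ b γ).dist x y ≤ level G o y := by omega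
  have h3' : (level G o x : ℝ) + (aiGraph G o Φ b γ).dist x y ≤ level G o y := by exact_mod_cast h3
  rw [gromovProduct, level_aiGraph hG hv, level_aiGraph hG hv]
  linarith

theorem Prec.theta_aiGraph_le (hG : IsRootedGraph G) (hv : IsVertical G o) (ha : 0 < a) {x y : X}
    (h : Prec G o y x) :
    theta (aiGraph G o Φ b γ) o a x y ≤ Real.exp (-a * level G o x) := by
  refine (theta_le_exp _ o a x y).trans (Real.exp_le_exp.2 ?_)
  have := h.level_le_gromovProduct_aiGraph (Φ := Φ) (b := b) (γ := γ) hG hv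
  nlinarith

theorem tendsto_exp_neg_mul_natCast (ha : 0 < a) :
    Tendsto (fun n : ℕ => Real.exp (-a * n)) atTop (𝓝 0) := by
  have h1 : Tendsto (fun m : ℕ => a * (m : ℝ)) atTop atTop :=
    tendsto_natCast_atTop_atTop.const_mul_atTop ha
  simpa [Function.comp_def] using Real.tendsto_exp_neg_atTop_nhds_zero.comp h1

theorem IsRay.exists_convergesTo (hG : IsRootedGraph G) (hv : IsVertical G o)
    (ha : IsGromovParameter (aiGraph G o Φ b γ) o a) {x : ℕ → X} (hx : IsRay G o x) :
    ∃ ξ : boundary (aiGraph G o Φ b γ) o a, ConvergesTo (aiGraph G o Φ b γ) o a x ξ := by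
  have hcauchy : CauchySeq fun i => toCompletion (aiGraph G o Φ b γ) o a (x i) := by
    refine cauchySeq_of_le_tendsto_0' (fun n : ℕ => Real.exp (-a * n)) (fun n m hnm => ?_)
      (tendsto_exp_neg_mul_natCast ha.1)
    rw [dist_toCompletion]
    have := (hx.prec hG hnm).theta_aiGraph_le (Φ := Φ) (b := b) (γ := γ) hG hv ha.1
    rwa [hx.level_eq] at this
  obtain ⟨ξ, hξ⟩ := cauchySeq_tendsto_of_complete hcauchy
  refine ⟨⟨ξ, ConvergesTo.mem_boundary (aiGraph_connected hG) ha hξ ?_⟩, hξ⟩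
  simp only [level_aiGraph hG hv, hx.level_eq]
  exact tendsto_id

/-- König's lemma yields a ray of ancestors of infinitely many terms of a sequence of vertices which
converges to `ξ`; this ray converges to `ξ` too. -/
theorem exists_ray_convergesTo (hG : IsRootedGraph G) (hv : IsVertical G o) (ha : 0 < a)
    (ξ : boundary (aiGraph G o Φ b γ) o a) :
    ∃ x, IsRay G o x ∧ ConvergesTo (aiGraph G o Φ b γ) o a x ξ := by
  obtain ⟨v, hvξ⟩ := exists_vertices_convergesTo (aiGraph G o Φ b γ) o a ξ
  have hlev : Tendsto (fun j => level G o (v j)) atTop atTop := by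
    refine tendsto_atTop.2 fun n => ?_
    have h := ((finite_level_lt (o := o) hG hv n).eventually_all).2
      fun x _ => hvξ.eventually_ne x
    filter_upwards [h] with j hj
    exact not_lt.1 fun hlt => hj _ hlt rfl
  obtain ⟨u, hu, hfreq⟩ := exists_ray_frequently_prec hG hv hlev
  refine ⟨u, hu, tendsto_iff_dist_tendsto_zero.2 ?_⟩
  refine squeeze_zero (fun _ => dist_nonneg) (fun i => ?_) (tendsto_exp_neg_mul_natCast ha)
  refine le_of_tendsto_of_frequently (tendsto_const_nhds.dist hvξ) ((hfreq i).mono fun j hj => ?_)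
  rw [dist_toCompletion]
  have := hj.theta_aiGraph_le (Φ := Φ) (b := b) (γ := γ) hG hv ha
  rwa [hu.level_eq] at this

theorem IsRay.mem_attractor {x : ℕ → X} (hx : IsRay G o x) {p : M} (hp : ∀ i, p ∈ Φ (x i)) :
    p ∈ attractor G o Φ :=
  Set.mem_iInter.2 fun n => Set.mem_biUnion (x := x n) (hx.level_eq n) (hp n)

theorem exists_ray_of_mem_attractor (hG : IsRootedGraph G) (hv : IsVertical G o)
    (hΦ : IsIndexMap G o Φ) {p : M} (hp : p ∈ attractor G o Φ) :
    ∃ x, IsRay G o x ∧ ∀ i, p ∈ Φ (x i) := by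
  have h : ∀ n, ∃ x, level G o x = n ∧ p ∈ Φ x := fun n => by
    obtain ⟨x, hx, hpx⟩ := Set.mem_iUnion₂.1 (Set.mem_iInter.1 hp n)
    exact ⟨x, hx, hpx⟩
  choose v hv1 hv2 using h
  obtain ⟨u, hu, hfreq⟩ := exists_ray_frequently_prec (v := v) hG hv (by
    simp only [hv1]
    exact tendsto_id)
  refine ⟨u, hu, fun i => ?_⟩
  obtain ⟨j, hj⟩ := (hfreq i).exists
  exact hΦ.subset_of_prec hG hv hj (hv2 j)

theorem IsRay.tendsto_point {C : ℝ} (hb : 0 < b)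
    (hdist : ∀ x, ∀ p ∈ Φ x, ∀ q ∈ Φ x, dist p q ≤ C * Real.exp (-b * level G o x))
    (hf : ∀ x, f x ∈ Φ x) {x : ℕ → X} (hx : IsRay G o x) {p : M} (hp : ∀ i, p ∈ Φ (x i)) :
    Tendsto (fun i => f (x i)) atTop (𝓝 p) := by
  refine tendsto_iff_dist_tendsto_zero.2 (squeeze_zero (fun _ => dist_nonneg) (fun i => ?_)
    (mul_zero C ▸ (tendsto_exp_neg_mul_natCast hb).const_mul C))
  have := hdist _ _ (hf (x i)) _ (hp i)
  rwa [hx.level_eq] at this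

theorem tendsto_levelDist {C : ℝ} (hb : 0 < b)
    (hdist : ∀ x, ∀ p ∈ Φ x, ∀ q ∈ Φ x, dist p q ≤ C * Real.exp (-b * level G o x))
    (hf : ∀ x, f x ∈ Φ x) {x y : ℕ → X} (hx : IsRay G o x) (hy : IsRay G o y) {p q : M}
    (hp : ∀ i, p ∈ Φ (x i)) (hq : ∀ i, q ∈ Φ (y i)) :
    Tendsto (fun i => levelDist G o b f (x i) (y i)) atTop (𝓝 (dist p q)) := by
  simp only [levelDist, hx.level_eq, hy.level_eq]
  simpa using ((tendsto_exp_neg_mul_natCast hb).add (tendsto_exp_neg_mul_natCast hb)).add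
    ((hx.tendsto_point hb hdist hf hp).dist (hy.tendsto_point hb hdist hf hq))

/-- Along two rays, `θ_a` tends to the distance of the limits of the rays in the boundary and
`levelDist` to the distance of the points of the attractor; so the comparison of both with the
Gromov product passes to the limit. -/
theorem exists_ray_estimate (hG : IsRootedGraph G) (hv : IsVertical G o) (hΦ : IsIndexMap G o Φ)
    (hb : 0 < b) (hexp : IsExponentialType G o Φ b) (hγ : 0 < γ)
    (ha : IsGromovParameter (aiGraph G o Φ b γ) o a) :
    ∃ C : ℝ, 1 ≤ C ∧ ∀ (x y : ℕ → X) (p q : M) (ξ η : GromovCompletion (aiGraph G o Φ b γ) o a),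
      IsRay G o x → IsRay G o y → (∀ i, p ∈ Φ (x i)) → (∀ i, q ∈ Φ (y i)) →
      ConvergesTo (aiGraph G o Φ b γ) o a x ξ → ConvergesTo (aiGraph G o Φ b γ) o a y η →
      C⁻¹ * dist p q ^ (a / b) ≤ dist ξ η ∧ dist ξ η ≤ C * dist p q ^ (a / b) := by
  choose f hf using fun x => (Φ x).nonempty
  obtain ⟨c₁, h₁⟩ := exists_levelDist_le hG hv hΦ hb hexp hγ.le hf
  obtain ⟨c₂, h₂⟩ := exists_exp_gromovProduct_le hG hv hΦ hb hγ hf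
  obtain ⟨C, hC, hdist⟩ := hexp.exists_dist_le hG hv
  have hs : 0 < a / b := div_pos ha.1 hb
  set c := max (max c₁ c₂) 1 with hc
  have hc1 : 1 ≤ c := le_max_right _ _
  have hcs : 1 ≤ c ^ (a / b) := Real.one_le_rpow hc1 hs.le
  have hpow : ∀ g : ℝ, Real.exp (-b * g) ^ (a / b) = Real.exp (-a * g) := by
    intro g
    rw [← Real.exp_mul]
    congr 1
    field_simp
  have key₁ : ∀ x y, levelDist G o b f x y ^ (a / b) ≤ c ^ (a / b) *
      (2 * theta (aiGraph G o Φ b γ) o a x y + Real.exp (-a * level G o x)) := by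
    intro x y
    have h : levelDist G o b f x y ≤
        c * Real.exp (-b * gromovProduct (aiGraph G o Φ b γ) o x y) :=
      (h₁ x y).trans (mul_le_mul_of_nonneg_right ((le_max_left _ _).trans (le_max_left _ _))
        (Real.exp_pos _).le)
    refine (Real.rpow_le_rpow (levelDist_pos G o b f x y).le h hs.le).trans ?_
    rw [Real.mul_rpow (by linarith) (Real.exp_pos _).le, hpow]
    have := exp_le_two_mul_theta_add ha x y
    rw [level_aiGraph hG hv] at this
    gcongr
  have key₂ : ∀ x y, theta (aiGraph G o Φ b γ) o a x y ≤
      c ^ (a / b) * levelDist G o b f x y ^ (a / b) := by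
    intro x y
    refine (theta_le_exp _ o a x y).trans ?_
    have hD := (levelDist_pos G o b f x y).le
    rw [← hpow, ← Real.mul_rpow (by linarith) hD]
    refine Real.rpow_le_rpow (Real.exp_pos _).le ((h₂ x y).trans ?_) hs.le
    exact mul_le_mul_of_nonneg_right ((le_max_right _ _).trans (le_max_left _ _)) hD
  refine ⟨2 * c ^ (a / b), by linarith, fun x y p q ξ η hx hy hp hq hξ hη => ?_⟩
  have hlim₁ := (tendsto_levelDist hb hdist hf hx hy hp hq).rpow_const
    (p := a / b) (Or.inr hs.le)
  have hlim₂ : Tendsto (fun i => theta (aiGraph G o Φ b γ) o a (x i) (y i)) atTop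
      (𝓝 (dist ξ η)) := by
    simpa only [dist_toCompletion] using Tendsto.dist hξ hη
  constructor
  · rw [inv_mul_le_iff₀ (by linarith)]
    have h := ((hlim₂.const_mul 2).add (tendsto_exp_neg_mul_natCast ha.1)).const_mul (c ^ (a / b))
    rw [add_zero, ← mul_assoc, mul_comm _ (2 : ℝ)] at h
    refine le_of_tendsto_of_tendsto' hlim₁ h fun i => ?_
    have := key₁ (x i) (y i)
    rwa [hx.level_eq] at this
  · have h := le_of_tendsto_of_tendsto' hlim₂ (hlim₁.const_mul (c ^ (a / b)))
      fun i => key₂ (x i) (y i)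
    refine h.trans (mul_le_mul_of_nonneg_right (by linarith) (by positivity))

theorem isHyperbolic_aiGraph (hG : IsRootedGraph G) (hv : IsVertical G o) (hΦ : IsIndexMap G o Φ)
    (hb : 0 < b) (hexp : IsExponentialType G o Φ b) (hγ : 0 < γ) :
    IsHyperbolic (aiGraph G o Φ b γ) o := by
  choose f hf using fun x => (Φ x).nonempty
  obtain ⟨c₁, h₁⟩ := exists_levelDist_le hG hv hΦ hb hexp hγ.le hf
  obtain ⟨c₂, h₂⟩ := exists_exp_gromovProduct_le hG hv hΦ hb hγ hf
  refine isHyperbolic_of_triangle hb (levelDist_triangle G o b f) h₁ h₂ ?_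
  by_contra hcon
  have h3 := levelDist_pos G o b f o o
  have h4 := (Real.exp_pos _).trans_le (h₂ o o)
  nlinarith

theorem exists_inducedMap_aiGraph (hG : IsRootedGraph G) (hv : IsVertical G o)
    (hΦ : IsIndexMap G o Φ) (hb : 0 < b) (hexp : IsExponentialType G o Φ b) (hγ : 0 < γ)
    (ha : IsGromovParameter (aiGraph G o Φ b γ) o a) :
    ∃ κ : boundary (aiGraph G o Φ b γ) o a → attractor G o Φ,
      IsInducedMap (aiGraph G o Φ b γ) o Φ a κ ∧ Function.Bijective κ ∧
      ∃ C : ℝ, 1 ≤ C ∧ ∀ ξ η : boundary (aiGraph G o Φ b γ) o a,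
        C⁻¹ * dist (κ ξ) (κ η) ^ (a / b) ≤ dist ξ η ∧
        dist ξ η ≤ C * dist (κ ξ) (κ η) ^ (a / b) := by
  obtain ⟨C, hC, hest⟩ := exists_ray_estimate hG hv hΦ hb hexp hγ ha
  have hs : a / b ≠ 0 := (div_pos ha.1 hb).ne'
  have hmem : ∀ {x : ℕ → X} {p : M}, ⋂ i, (Φ (x i) : Set M) = {p} → ∀ i, p ∈ Φ (x i) := by
    intro x p h i
    exact Set.mem_iInter.1 (h ▸ Set.mem_singleton p) i
  have heq : ∀ {p q : M}, C⁻¹ * dist p q ^ (a / b) ≤ 0 → p = q := by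
    intro p q h
    have h1 : dist p q ^ (a / b) ≤ 0 := by
      by_contra hcon
      have := mul_pos (inv_pos.2 (zero_lt_one.trans_le hC)) (not_le.1 hcon)
      linarith
    have h2 := le_antisymm h1 (Real.rpow_nonneg dist_nonneg _)
    exact dist_eq_zero.1 ((Real.rpow_eq_zero dist_nonneg hs).1 h2)
  choose x hx hxξ using fun ξ => exists_ray_convergesTo (Φ := Φ) (b := b) (γ := γ) hG hv ha.1 ξ
  choose p hp using fun ξ => hΦ.singleton (x ξ) (hx ξ)
  let κ : boundary (aiGraph G o Φ b γ) o a → attractor G o Φ :=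
    fun ξ => ⟨p ξ, (hx ξ).mem_attractor (hmem (hp ξ))⟩
  have hκ : ∀ ξ η, C⁻¹ * dist (κ ξ) (κ η) ^ (a / b) ≤ dist ξ η ∧
      dist ξ η ≤ C * dist (κ ξ) (κ η) ^ (a / b) := fun ξ η =>
    hest _ _ _ _ _ _ (hx ξ) (hx η) (hmem (hp ξ)) (hmem (hp η)) (hxξ ξ) (hxξ η)
  -- Two rays with the same limit determine the same point of the attractor.
  have hwell : ∀ (y : ℕ → X) (ξ : boundary (aiGraph G o Φ b γ) o a) (q : M), IsRay G o y →
      (∀ i, q ∈ Φ (y i)) → ConvergesTo (aiGraph G o Φ b γ) o a y ξ → q = κ ξ := by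
    intro y ξ q hy hq hyξ
    have h := (hest _ _ _ _ _ _ hy (hx ξ) hq (hmem (hp ξ)) hyξ (hxξ ξ)).1
    rw [dist_self] at h
    exact heq h
  refine ⟨κ, ⟨fun y hy => ?_, fun ξ => ⟨x ξ, (isRay_aiGraph_iff hG hv).2 (hx ξ), hxξ ξ⟩,
    fun y ξ hy hyξ => ?_⟩, ⟨fun ξ η h => ?_, ?_⟩, C, hC, hκ⟩
  · exact ((isRay_aiGraph_iff hG hv).1 hy).exists_convergesTo hG hv ha
  · have hy' := (isRay_aiGraph_iff hG hv).1 hy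
    obtain ⟨q, hq⟩ := hΦ.singleton y hy'
    rw [hq, hwell y ξ q hy' (hmem hq) hyξ]
  · have h1 := (hκ ξ η).2
    rw [h, dist_self, Real.zero_rpow hs, mul_zero] at h1
    exact dist_le_zero.1 h1
  · rintro ⟨q, hq⟩
    obtain ⟨y, hy, hqy⟩ := exists_ray_of_mem_attractor hG hv hΦ hq
    obtain ⟨ξ, hξ⟩ := hy.exists_convergesTo hG hv ha
    exact ⟨ξ, Subtype.ext (hwell y ξ q hy hqy hξ).symm⟩

end Boundary

end IndexGraph

theorem theorem4p5 {X : Type*} {M : Type*} [MetricSpace M] [CompleteSpace M]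
    (G : SimpleGraph X) (o : X) (hG : IsRootedGraph G) (hv : IsVertical G o)
    (hne : ∀ x, (descendants G o 1 x).Nonempty)
    (Φ : X → TopologicalSpace.NonemptyCompacts M) (hΦ : IsIndexMap G o Φ)
    (b : ℝ) (hb : 0 < b) (hexp : IsExponentialType G o Φ b)
    (γ : ℝ) (hγ : 0 < γ) :
    (∃ m : ℕ, 1 ≤ m ∧ IsDeparting (aiGraph G o Φ b γ) o m 1) ∧
    IsAdmissible (aiGraph G o Φ b γ) o Φ ∧
    ∀ a : ℝ, IsGromovParameter (aiGraph G o Φ b γ) o a →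
      ∃ κ : boundary (aiGraph G o Φ b γ) o a → attractor G o Φ,
        IsInducedMap (aiGraph G o Φ b γ) o Φ a κ ∧ Function.Bijective κ ∧
        ∃ C : ℝ, 1 ≤ C ∧ ∀ ξ η : boundary (aiGraph G o Φ b γ) o a,
          C⁻¹ * dist (κ ξ) (κ η) ^ (a / b) ≤ dist ξ η ∧
          dist ξ η ≤ C * dist (κ ξ) (κ η) ^ (a / b) := by
  refine ⟨exists_isDeparting_aiGraph hG hv hΦ hb hexp hγ,
    ⟨isExpansive_aiGraph hG hv hΦ hb.le hγ.le, isHyperbolic_aiGraph hG hv hΦ hb hexp hγ, ?_, ?_⟩,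
    fun a ha => exists_inducedMap_aiGraph hG hv hΦ hb hexp hγ ha⟩
  · rwa [verticalPart_aiGraph hG hv]
  · intro a ha
    rw [verticalPart_aiGraph hG hv]
    obtain ⟨κ, h1, h2, -⟩ := exists_inducedMap_aiGraph hG hv hΦ hb hexp hγ ha
    exact ⟨κ, h1, h2⟩
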